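/- Let $n,q\ge 0$ be integers, let $\|\cdot\|$ be the Euclidean norm on $\mathbb{C}^n$, and let $U\subset\mathbb{C}^n$ be a non-empty open set. Definitions. An upper semicontinuous function $u:U\to[-\infty,\infty)$ is called $q$-plurisubharmonic ($q$-psh) on $U$ if either $q\ge n$, or $q<n$ and for every $(q+1)$-dimensional complex affine subspace $\pi\subset\mathbb{C}^n$ the restriction of $u$ to $U\cap\pi$ is subpluriharmonic; that is, either $u\equiv-\infty$ on $U\cap\pi$ or, for every compact ball $\overline{B}\subset U\cap\pi$ of $\pi$ and every real-valued continuous plurisubharmonic function $h$ on a neighbourhood of $\overline{B}$ in $\pi$, the sum $u+h$ attains its maximum over $\overline{B}$ at a point of the boundary of $B$ in $\pi$. For $v:U\to[-\infty,\infty)$ and $\Phi:\mathbb{C}^n\to\mathbb{R}$, the sup-convolution is $$[v]_U^\Phi(y)=\sup_{x\in U}\{v(x)+\Phi(y-x)\}\in[-\infty,\infty],\qquad y\in\mathbb{C}^n,$$ and its proper set of definition is the set of all $y\in\mathbb{C}^n$ for which this supremum is attained, i.e. equals $v(\hat x)+\Phi(y-\hat x)$ for some $\hat x\in U$. The function $\Phi$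 is semiconvex with constant $\delta>0$ if $\Phi+\delta\|\cdot\|^2$ is convex on $\mathbb{C}^n$. Statement. Let $\Phi:\mathbb{C}^n\to\mathbb{R}$ be continuous and semiconvex with some constant $\delta>0$, and let $u$ be $q$-psh on $U$. Let $\mathcal{A}\in\mathbb{C}^{n\times n}$ be a constant Hermitian matrix, put $g(y)=y^t\mathcal{A}\overline{y}$ (a real number), and suppose that the proper set of definition of $[u+g]_U^\Phi$ has non-empty interior $W$. Then the restriction of $[u+g]_U^\Phi-g$ to $W$ is continuous (as a function with values in $[-\infty,\infty)$, and real-valued unless $u\equiv-\infty$ on $U$) and $q$-psh on $W$. In particular ($g=0$), if the proper set of definition of the sup-convolution $[u]_U^\Phi$ has non-empty interior $W$, then the restriction of $[u]_U^\Phi$ to $W$ is continuous (in the same sense) and $q$-psh on $W$. -/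

import Mathlib

/-- A real-valued function `h` is continuous and plurisubharmonic on `S`, where `S` is meant to be
a relatively open subset of a complex affine subspace: it is continuous on `S` and satisfies the
sub-mean value inequality on every closed complex disc `{a + ζ b : |ζ| ≤ 1}` contained in `S`. -/
def IsContPSHOn {n : ℕ} (h : EuclideanSpace ℂ (Fin n) → ℝ)
    (S : Set (EuclideanSpace ℂ (Fin n))) : Prop :=
  ContinuousOn h S ∧
    ∀ a b : EuclideanSpace ℂ (Fin n), (∀ ζ : ℂ, ‖ζ‖ ≤ 1 → a + ζ • b ∈ S) →
      h a ≤ Real.circleAverage (fun ζ : ℂ => h (a + ζ • b)) 0 1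

/-- `u` is subpluriharmonic on `U ∩ π`, for `U` open in `ℂⁿ` and `π` a complex affine subspace:
it is upper semicontinuous there with values in `[-∞, ∞)`, and either it is identically `-∞` there
or, for every compact ball `B` of `π` contained in `U ∩ π` and every continuous plurisubharmonic
function `h` on a neighbourhood of `B` in `π`, the maximum of `u + h` over `B` is attained at a
point of the boundary sphere of `B` in `π`. -/
def IsSubpluriharmonicOn {n : ℕ} (u : EuclideanSpace ℂ (Fin n) → EReal)
    (U : Set (EuclideanSpace ℂ (Fin n))) (π : AffineSubspace ℂ (EuclideanSpace ℂ (Fin n))) :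
    Prop :=
  UpperSemicontinuousOn u (U ∩ π) ∧ (∀ z ∈ U ∩ π, u z < ⊤) ∧
    ((∀ z ∈ U ∩ π, u z = ⊥) ∨
      ∀ c ∈ π, ∀ r : ℝ, 0 < r → Metric.closedBall c r ∩ π ⊆ U →
        ∀ (V : Set (EuclideanSpace ℂ (Fin n))) (h : EuclideanSpace ℂ (Fin n) → ℝ),
          IsOpen V → Metric.closedBall c r ∩ π ⊆ V → IsContPSHOn h (V ∩ π) →
            ∃ z ∈ Metric.sphere c r ∩ π, ∀ w ∈ Metric.closedBall c r ∩ π,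
              u w + (h w : EReal) ≤ u z + (h z : EReal))

/-- `u` is `q`-plurisubharmonic on the open set `U ⊆ ℂⁿ`: it is upper semicontinuous on `U` with
values in `[-∞, ∞)` and, if `q < n`, it is subpluriharmonic on `U ∩ π` for every
`(q + 1)`-dimensional complex affine subspace `π` (there is no further condition if `n ≤ q`). -/
def IsQPSHOn {n : ℕ} (q : ℕ) (u : EuclideanSpace ℂ (Fin n) → EReal)
    (U : Set (EuclideanSpace ℂ (Fin n))) : Prop :=
  UpperSemicontinuousOn u U ∧ (∀ z ∈ U, u z < ⊤) ∧
    (q < n → ∀ π : AffineSubspace ℂ (EuclideanSpace ℂ (Fin n)),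
      Module.finrank ℂ π.direction = q + 1 → IsSubpluriharmonicOn u U π)

/-- The sup-convolution `u_X^Φ(y) = sup_{x ∈ X} (u(x) + Φ(y - x))`. -/
noncomputable def supConv {n : ℕ} (u Φ : EuclideanSpace ℂ (Fin n) → EReal)
    (X : Set (EuclideanSpace ℂ (Fin n))) (y : EuclideanSpace ℂ (Fin n)) : EReal :=
  ⨆ x ∈ X, (u x + Φ (y - x))

/-- The proper set of definition of `u_X^Φ`: the points where the supremum is attained in `X`. -/
def properSet {n : ℕ} (u Φ : EuclideanSpace ℂ (Fin n) → EReal)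
    (X : Set (EuclideanSpace ℂ (Fin n))) : Set (EuclideanSpace ℂ (Fin n)) :=
  {y | ∃ x ∈ X, supConv u Φ X y = u x + Φ (y - x)}

/-- A real-valued function on `ℂⁿ` is semiconvex with constant `δ > 0`. -/
def IsSemiconvex {n : ℕ} (δ : ℝ) (Ψ : EuclideanSpace ℂ (Fin n) → ℝ) : Prop :=
  0 < δ ∧ ConvexOn ℝ Set.univ (fun y => Ψ y + δ * ‖y‖ ^ 2)

/-- The quadratic form `y ↦ yᵗ A ȳ`; for Hermitian `A` its values are real,
see `hermForm_coe`. -/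
noncomputable def hermForm {n : ℕ} (A : Matrix (Fin n) (Fin n) ℂ)
    (y : EuclideanSpace ℂ (Fin n)) : ℝ :=
  (∑ k, ∑ l, y k * A k l * (starRingEnd ℂ) (y l)).re

theorem hermForm_coe {n : ℕ} {A : Matrix (Fin n) (Fin n) ℂ} (hA : A.IsHermitian)
    (y : EuclideanSpace ℂ (Fin n)) :
    (hermForm A y : ℂ) = ∑ k, ∑ l, y k * A k l * (starRingEnd ℂ) (y l) := by
  refine Complex.conj_eq_iff_re.mp ?_
  rw [map_sum, Finset.sum_congr rfl fun k _ => map_sum _ _ _, Finset.sum_comm]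
  refine Finset.sum_congr rfl fun k _ => Finset.sum_congr rfl fun l _ => ?_
  have h := hA.apply k l
  rw [map_mul, map_mul, Complex.conj_conj, ← h]
  simp only [Complex.star_def]
  ring

/-!
Let `v` be the sup-convolution of `u + g`, with `g = hermForm A`. At a point `y ∈ W` the supremum
is attained at some `x ∈ U`. With `s = y - x` the function
`z ↦ u (z - s) + g (z - s) + Φ s - g z` lies below `v - g` and touches it at `y`. Since
`g (z - s) - g z` is a real affine function of `z` (`hermForm_add_eq`), the touching function is a
translate of `u` plus a pluriharmonic function.

This is enough for the maximum principle (`isQPSHOn_of_touching`). Suppose that `v - g + h`, for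
`h` continuous plurisubharmonic near a ball with centre `c` in a slice, exceeds somewhere in the
ball its maximum over the sphere. For small `ε > 0` the function `v - g + h + ε ‖· - c‖²` has a
maximum over the ball at an interior point `y`. The function touching at `y`, plus
`h + ε ‖· - c‖² - ε ‖· - y‖²`, then has a strict maximum at `y` on small balls of the slice. But
`‖· - c‖² - ‖· - y‖²` is real affine, so that `h + ε ‖· - c‖² - ε ‖· - y‖²` is again
plurisubharmonic, which contradicts the maximum principle for `u` on the translated slice.

Semiconvexity of `Φ` enters only through continuity (`continuousOn_of_semiconvex_touching`):
`v + δ ‖·‖²` is a supremum of the convex functions `Φ (· - x) + δ ‖·‖²` plus constants, finite on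
`W`, hence locally convex and continuous. If `u` is identically `-∞` on `U`, so is `v`.
-/

/-! ### Translates and affine perturbations of plurisubharmonic functions -/

/-- A real-linear function has the mean value property on complex discs: along a complex line it
is the real part of a complex affine function. -/
theorem circleAverage_realLinear {n : ℕ} (φ : EuclideanSpace ℂ (Fin n) →L[ℝ] ℝ)
    (a b : EuclideanSpace ℂ (Fin n)) :
    Real.circleAverage (fun ζ : ℂ => φ (a + ζ • b)) 0 1 = φ a := by
  set k : ℂ := ⟨φ b, -φ (Complex.I • b)⟩ with hk
  have hφ : ∀ ζ : ℂ, φ (a + ζ • b) = ((φ a : ℂ) + k * ζ).re := by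
    intro ζ
    have hζ : ζ • b = ζ.re • b + ζ.im • (Complex.I • b) := by
      ext j
      simp only [PiLp.smul_apply, PiLp.add_apply, smul_eq_mul, Complex.real_smul]
      conv_lhs => rw [← Complex.re_add_im ζ]
      ring
    rw [hζ]
    simp only [map_add, map_smul, smul_eq_mul, hk, Complex.add_re, Complex.ofReal_re,
      Complex.mul_re]
    ring
  have hharm : InnerProductSpace.HarmonicOnNhd (fun ζ : ℂ => ((φ a : ℂ) + k * ζ).re)
      (Metric.closedBall 0 |1|) := fun ζ _ =>
    AnalyticAt.harmonicAt_re (by fun_prop)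
  simp only [hφ]
  rw [InnerProductSpace.HarmonicOnNhd.circleAverage_eq hharm]
  simp

/-- Continuous plurisubharmonic functions are stable under translation and under adding real affine
functions, which are pluriharmonic. -/
theorem IsContPSHOn.translate_add_affine {n : ℕ} {h : EuclideanSpace ℂ (Fin n) → ℝ}
    {S S' : Set (EuclideanSpace ℂ (Fin n))} (hh : IsContPSHOn h S)
    (s : EuclideanSpace ℂ (Fin n)) (hS : ∀ x ∈ S', x + s ∈ S)
    (φ : EuclideanSpace ℂ (Fin n) →L[ℝ] ℝ) (C : ℝ) :
    IsContPSHOn (fun x => h (x + s) + (φ x + C)) S' := by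
  refine ⟨(hh.1.comp (by fun_prop) hS).add (by fun_prop), fun a b hab => ?_⟩
  have hab' : ∀ ζ : ℂ, ‖ζ‖ ≤ 1 → (a + s) + ζ • b ∈ S := fun ζ hζ => by
    have := hS _ (hab ζ hζ)
    rwa [add_right_comm] at this
  have h1 := hh.2 (a + s) b hab'
  have hi1 : CircleIntegrable (fun ζ : ℂ => h ((a + s) + ζ • b)) 0 1 := by
    refine ContinuousOn.circleIntegrable zero_le_one ?_
    refine hh.1.comp (by fun_prop) fun ζ hζ => hab' ζ ?_
    simpa using (mem_sphere_zero_iff_norm.mp hζ).le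
  have hi2 : CircleIntegrable (fun ζ : ℂ => φ (a + ζ • b)) 0 1 :=
    ContinuousOn.circleIntegrable zero_le_one (by fun_prop)
  have hi3 : CircleIntegrable (fun _ : ℂ => C) 0 1 :=
    ContinuousOn.circleIntegrable zero_le_one (by fun_prop)
  have key : (fun ζ : ℂ => h (a + ζ • b + s) + (φ (a + ζ • b) + C)) =
      (fun ζ : ℂ => h ((a + s) + ζ • b)) + ((fun ζ : ℂ => φ (a + ζ • b)) + fun _ : ℂ => C) := by
    funext ζ
    simp only [Pi.add_apply, add_right_comm a s]
  rw [key, Real.circleAverage_add hi1 (hi2.add hi3), Real.circleAverage_add hi2 hi3,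
    circleAverage_realLinear, Real.circleAverage_const]
  linarith

/-! ### Functions touched from below by `q`-plurisubharmonic functions -/

/-- A continuous function on `W` that is touched from below at every point of `W` by a translate
of a `q`-plurisubharmonic function plus a real affine function is `q`-plurisubharmonic: if `f + h`
violated the maximum principle on a ball, then at an interior maximum of `f + h + ε ‖· - c‖²` the
touching function would violate it as well. -/
theorem isQPSHOn_of_touching {n q : ℕ} {u : EuclideanSpace ℂ (Fin n) → EReal}
    {f : EuclideanSpace ℂ (Fin n) → ℝ} {U W : Set (EuclideanSpace ℂ (Fin n))}
    (hU : IsOpen U) (hu : IsQPSHOn q u U) (hf : ContinuousOn f W)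
    (htouch : ∀ y ∈ W, ∃ x ∈ U, ∃ (φ : EuclideanSpace ℂ (Fin n) →L[ℝ] ℝ) (C : ℝ),
      (f y : EReal) = u x + ((φ x + C : ℝ) : EReal) ∧
      ∀ x' ∈ U, x' + (y - x) ∈ W →
        u x' + ((φ x' + C : ℝ) : EReal) ≤ (f (x' + (y - x)) : EReal)) :
    IsQPSHOn q (fun y => (f y : EReal)) W := by
  have hfE : ContinuousOn (fun y => (f y : EReal)) W :=
    continuous_coe_real_ereal.comp_continuousOn hf
  refine ⟨hfE.upperSemicontinuousOn, fun z _ => EReal.coe_lt_top _, fun hq π hπ => ?_⟩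
  refine ⟨(hfE.mono Set.inter_subset_left).upperSemicontinuousOn, fun z _ => EReal.coe_lt_top _,
    Or.inr fun c hc r hr hcW V h hV hcV hh => ?_⟩
  have hK : IsCompact (Metric.closedBall c r ∩ (π : Set (EuclideanSpace ℂ (Fin n)))) :=
    (isCompact_closedBall c r).inter_right π.closed_of_finiteDimensional
  have hS : IsCompact (Metric.sphere c r ∩ (π : Set (EuclideanSpace ℂ (Fin n)))) :=
    (isCompact_sphere c r).inter_right π.closed_of_finiteDimensional
  have hSK : Metric.sphere c r ∩ (π : Set (EuclideanSpace ℂ (Fin n))) ⊆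
      Metric.closedBall c r ∩ π := Set.inter_subset_inter_left _ Metric.sphere_subset_closedBall
  have hcont : ContinuousOn (fun z => f z + h z)
      (Metric.closedBall c r ∩ (π : Set (EuclideanSpace ℂ (Fin n)))) :=
    (hf.mono hcW).add (hh.1.mono fun z hz => ⟨hcV hz, hz.2⟩)
  -- The slice has positive dimension, so it meets the sphere.
  have hSne : (Metric.sphere c r ∩ (π : Set (EuclideanSpace ℂ (Fin n)))).Nonempty := by
    have : Nontrivial π.direction := Module.nontrivial_of_finrank_pos (R := ℂ) (by omega)
    obtain ⟨v, hv⟩ := exists_ne (0 : π.direction)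
    have hv' : ‖(v : EuclideanSpace ℂ (Fin n))‖ ≠ 0 := by simpa using hv
    refine ⟨((r / ‖(v : EuclideanSpace ℂ (Fin n))‖ : ℝ) : ℂ) • (v : EuclideanSpace ℂ (Fin n)) + c,
      ?_, AffineSubspace.vadd_mem_of_mem_direction (π.direction.smul_mem _ v.2) hc⟩
    rw [mem_sphere_iff_norm, add_sub_cancel_right, norm_smul, Complex.norm_real, Real.norm_eq_abs,
      abs_of_nonneg (by positivity), div_mul_cancel₀ _ hv']
  obtain ⟨z₀, hz₀, hmax⟩ := hS.exists_isMaxOn hSne (hcont.mono hSK)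
  refine ⟨z₀, hz₀, ?_⟩
  by_contra! hcon
  obtain ⟨w, hw, hlt⟩ := hcon
  have hlt' : f z₀ + h z₀ < f w + h w := by exact_mod_cast hlt
  -- This `ε` keeps the maximum of `f + h + ε ‖· - c‖²` over the ball off the sphere.
  obtain ⟨ε, hε, hεr⟩ : ∃ ε : ℝ, 0 < ε ∧ f z₀ + h z₀ + ε * r ^ 2 < f w + h w := by
    refine ⟨(f w + h w - (f z₀ + h z₀)) / (2 * r ^ 2), by
      have : 0 < f w + h w - (f z₀ + h z₀) := by linarith
      positivity, ?_⟩
    have : (f w + h w - (f z₀ + h z₀)) / (2 * r ^ 2) * r ^ 2 =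
        (f w + h w - (f z₀ + h z₀)) / 2 := by field_simp
    rw [this]; linarith
  obtain ⟨y, hy, hymax⟩ := hK.exists_isMaxOn ⟨w, hw⟩
    (hcont.add (f := fun z => f z + h z) (g := fun z => ε * ‖z - c‖ ^ 2) (by fun_prop))
  simp only [isMaxOn_iff, Pi.add_apply] at hymax hmax
  have hyball : y ∈ Metric.ball c r := by
    rcases (Metric.mem_closedBall.mp hy.1).lt_or_eq with hlt | heq
    · exact hlt
    · exfalso
      have h1 := hymax w hw
      have h2 := hmax y ⟨heq, hy.2⟩
      rw [← dist_eq_norm y c, heq] at h1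
      nlinarith [sq_nonneg ‖w - c‖]
  obtain ⟨x, hx, φ, C, hfy, hbelow⟩ := htouch y (hcW hy)
  set s := y - x with hs
  have hxs : x + s = y := by rw [hs]; abel
  obtain ⟨ρ, hρ, hρc, hρU⟩ : ∃ ρ > 0, Metric.closedBall y ρ ⊆ Metric.closedBall c r ∧
      Metric.closedBall x ρ ⊆ U := by
    obtain ⟨ρ₁, h1, h1'⟩ := Metric.nhds_basis_closedBall.mem_iff.mp
      (Metric.isOpen_ball.mem_nhds hyball)
    obtain ⟨ρ₂, h2, h2'⟩ := Metric.nhds_basis_closedBall.mem_iff.mp (hU.mem_nhds hx)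
    exact ⟨min ρ₁ ρ₂, lt_min h1 h2,
      (Metric.closedBall_subset_closedBall (min_le_left _ _)).trans
        (h1'.trans Metric.ball_subset_closedBall),
      (Metric.closedBall_subset_closedBall (min_le_right _ _)).trans h2'⟩
  set π' : AffineSubspace ℂ (EuclideanSpace ℂ (Fin n)) := AffineSubspace.mk' x π.direction with hπ'
  have hmem : ∀ z ∈ π', z + s ∈ π := by
    intro z hz
    have hd : z - x ∈ π.direction := hz
    have := AffineSubspace.vadd_mem_of_mem_direction hd hy.2
    rwa [vadd_eq_add, show z - x + y = z + s by rw [hs]; abel] at this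
  obtain ⟨-, hutop, hdich⟩ := hu.2.2 hq π' (by rw [hπ', AffineSubspace.direction_mk', hπ])
  have hxπ : x ∈ π' := AffineSubspace.self_mem_mk' _ _
  have hux : u x ≠ ⊥ := by
    intro hb
    rw [hb, EReal.bot_add] at hfy
    exact EReal.coe_ne_bot _ hfy
  have hsub := hdich.resolve_left fun hall => hux (hall x ⟨hx, hxπ⟩)
  -- The test function for `u` on a ball around `x` is `h (z + s)` plus the affine part of the
  -- touching function plus `ε * (‖z + s - c‖ ^ 2 - ‖z - x‖ ^ 2)`. The last summand is real affine,
  -- with linear part `ε • ψ`, and makes the maximum at `x` strict.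
  set ψ : EuclideanSpace ℂ (Fin n) →L[ℝ] ℝ := (2 : ℝ) • innerSL ℝ (y - c) with hψ
  have haff : ∀ z : EuclideanSpace ℂ (Fin n), ‖z + s - c‖ ^ 2 - ‖z - x‖ ^ 2 =
      ψ z + (‖y - c‖ ^ 2 - ψ x) := by
    intro z
    rw [show z + s - c = (y - c) + (z - x) by rw [hs]; abel, norm_add_sq_real]
    simp only [hψ, smul_apply, innerSL_apply_apply, smul_eq_mul, inner_sub_right]
    ring
  obtain ⟨z, ⟨hzs, hzπ⟩, hz⟩ := hsub x hxπ ρ hρ (Set.inter_subset_left.trans hρU)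
    ((fun z => z + s) ⁻¹' V) (fun z => h (z + s) + ((φ + ε • ψ) z + (C + ε * (‖y - c‖ ^ 2 - ψ x))))
    (hV.preimage (by fun_prop)) (fun z hz => hcV ⟨hρc (by
      have := hz.1
      rw [mem_closedBall_iff_norm] at this ⊢
      rwa [show z + s - y = z - x by rw [hs]; abel]), hmem z hz.2⟩)
    (hh.translate_add_affine s (fun z hz => ⟨hz.1, hmem z hz.2⟩) _ _)
  have hzx := hz x ⟨Metric.mem_closedBall_self hρ.le, hxπ⟩
  have hzU : z ∈ U := hρU (Metric.sphere_subset_closedBall hzs)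
  have hzK : z + s ∈ Metric.closedBall c r ∩ (π : Set (EuclideanSpace ℂ (Fin n))) := by
    refine ⟨hρc ?_, hmem z hzπ⟩
    have := Metric.sphere_subset_closedBall hzs
    rw [mem_closedBall_iff_norm] at this ⊢
    rwa [show z + s - y = z - x by rw [hs]; abel]
  have hle := hbelow z hzU (hcW hzK)
  have hmx := hymax _ hzK
  have haz := haff z
  rw [mem_sphere_iff_norm] at hzs
  rw [hzs] at haz
  have hut := (hutop x ⟨hx, hxπ⟩).ne
  have huzt := (hutop z ⟨hzU, hzπ⟩).ne
  lift u x to ℝ using ⟨hut, hux⟩ with ux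
  by_cases huz : u z = ⊥
  · rw [huz, EReal.bot_add, le_bot_iff, ← EReal.coe_add] at hzx
    exact EReal.coe_ne_bot _ hzx
  lift u z to ℝ using ⟨huzt, huz⟩ with uz
  norm_cast at hfy hle hzx
  simp only [add_apply, smul_apply, smul_eq_mul, hxs] at hzx
  -- Together the inequalities say `ε * ρ ^ 2 ≤ 0`.
  have hazε := congrArg (ε * ·) haz
  linarith [mul_pos hε (pow_pos hρ 2)]

/-- Being `q`-plurisubharmonic on `W` depends only on the values on `W`. -/
theorem IsQPSHOn.congr {n q : ℕ} {u v : EuclideanSpace ℂ (Fin n) → EReal}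
    {W : Set (EuclideanSpace ℂ (Fin n))} (hu : IsQPSHOn q u W) (h : Set.EqOn v u W) :
    IsQPSHOn q v W := by
  have husc : ∀ {S}, S ⊆ W → UpperSemicontinuousOn u S → UpperSemicontinuousOn v S := by
    intro S hS hus x hx c hc
    rw [h (hS hx)] at hc
    filter_upwards [hus x hx c hc, self_mem_nhdsWithin] with z hz hzS
    rwa [h (hS hzS)]
  refine ⟨husc subset_rfl hu.1, fun z hz => h hz ▸ hu.2.1 z hz, fun hq π hπ => ?_⟩
  obtain ⟨h1, h2, h3⟩ := hu.2.2 hq π hπ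
  refine ⟨husc Set.inter_subset_left h1, fun z hz => h hz.1 ▸ h2 z hz, h3.imp
    (fun h3 z hz => (h hz.1).trans (h3 z hz)) fun h3 c hc r hr hcW V g hV hcV hg => ?_⟩
  obtain ⟨z, hz, hzmax⟩ := h3 c hc r hr hcW V g hV hcV hg
  refine ⟨z, hz, fun w hw => ?_⟩
  rw [h (hcW hw), h (hcW ⟨Metric.sphere_subset_closedBall hz.1, hz.2⟩)]
  exact hzmax w hw

/-! ### The Hermitian form -/

/-- Translating the form changes it by a real affine function, hence by a pluriharmonic one. -/
theorem hermForm_add_eq {n : ℕ} (A : Matrix (Fin n) (Fin n) ℂ) (s : EuclideanSpace ℂ (Fin n)) :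
    ∃ φ : EuclideanSpace ℂ (Fin n) →L[ℝ] ℝ, ∀ x,
      hermForm A (x + s) = hermForm A x + φ x + hermForm A s := by
  let φ : EuclideanSpace ℂ (Fin n) →ₗ[ℝ] ℝ :=
    { toFun := fun x => (∑ k, ∑ l, (x k * A k l * (starRingEnd ℂ) (s l) +
        s k * A k l * (starRingEnd ℂ) (x l))).re
      map_add' := fun x y => by
        simp only [PiLp.add_apply, map_add, ← Complex.add_re, ← Finset.sum_add_distrib]
        congr 1
        refine Finset.sum_congr rfl fun k _ => Finset.sum_congr rfl fun l _ => ?_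
        ring
      map_smul' := fun c x => by
        simp only [PiLp.smul_apply, Complex.real_smul, map_mul, Complex.conj_ofReal,
          RingHom.id_apply, smul_eq_mul, ← Complex.re_ofReal_mul, Finset.mul_sum]
        congr 1
        refine Finset.sum_congr rfl fun k _ => Finset.sum_congr rfl fun l _ => ?_
        ring }
  refine ⟨LinearMap.toContinuousLinearMap φ, fun x => ?_⟩
  change _ = _ + φ x + _
  simp only [hermForm, φ, LinearMap.coe_mk, AddHom.coe_mk, PiLp.add_apply, map_add,
    ← Complex.add_re, ← Finset.sum_add_distrib]
  congr 1
  refine Finset.sum_congr rfl fun k _ => Finset.sum_congr rfl fun l _ => ?_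
  ring

theorem continuous_hermForm {n : ℕ} (A : Matrix (Fin n) (Fin n) ℂ) : Continuous (hermForm A) := by
  unfold hermForm
  fun_prop

/-! ### Continuity -/

/-- For `Φ` semiconvex, a real function on an open set which is touched from below at every point
by a translate of `Φ` plus a constant is continuous, being locally a convex function minus
`δ ‖·‖²`. -/
theorem continuousOn_of_semiconvex_touching {n : ℕ} {δ : ℝ}
    {Φ F : EuclideanSpace ℂ (Fin n) → ℝ} (hΦ : IsSemiconvex δ Φ)
    {W : Set (EuclideanSpace ℂ (Fin n))} (hW : IsOpen W)
    (htouch : ∀ y ∈ W, ∃ (x : EuclideanSpace ℂ (Fin n)) (t : ℝ), F y = t + Φ (y - x) ∧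
      ∀ z ∈ W, t + Φ (z - x) ≤ F z) :
    ContinuousOn F W := by
  intro y₀ hy₀
  obtain ⟨r, hr, hball⟩ := Metric.isOpen_iff.mp hW y₀ hy₀
  have hconv : ConvexOn ℝ (Metric.ball y₀ r) (fun y => F y + δ * ‖y‖ ^ 2) := by
    refine ⟨convex_ball _ _, fun y₁ h₁ y₂ h₂ a b ha hb hab => ?_⟩
    obtain ⟨x, t, hF, hle⟩ := htouch _ (hball (convex_ball y₀ r h₁ h₂ ha hb hab))
    have hc := hΦ.2.2 (Set.mem_univ (y₁ - x)) (Set.mem_univ (y₂ - x)) ha hb hab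
    have e : a • (y₁ - x) + b • (y₂ - x) = a • y₁ + b • y₂ - x := by
      rw [smul_sub, smul_sub, sub_add_sub_comm, ← add_smul, hab, one_smul]
    have i : inner ℝ (a • y₁ + b • y₂) x = a * inner ℝ y₁ x + b * inner ℝ y₂ x := by
      rw [inner_add_left, real_inner_smul_left, real_inner_smul_left]
    simp only [e, smul_eq_mul, norm_sub_sq_real, i] at hc
    simp only [smul_eq_mul, hF]
    have l₁ := mul_le_mul_of_nonneg_left (hle y₁ (hball h₁)) ha
    have l₂ := mul_le_mul_of_nonneg_left (hle y₂ (hball h₂)) hb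
    obtain rfl : b = 1 - a := by linarith
    nlinarith
  have hcont := (hconv.continuousOn Metric.isOpen_ball).sub
    (show ContinuousOn (fun y : EuclideanSpace ℂ (Fin n) => δ * ‖y‖ ^ 2) (Metric.ball y₀ r) by
      fun_prop)
  have hcont' : ContinuousOn F (Metric.ball y₀ r) := by
    refine hcont.congr fun y _ => ?_
    simp
  exact (hcont'.continuousAt (Metric.ball_mem_nhds y₀ hr)).continuousWithinAt

/-! ### Sup-convolutions -/

/-- The sup-convolution of `u + hermForm A` minus `hermForm A`, on the interior of its proper set of
definition. The matrix need not be Hermitian, because `hermForm` takes the real part. -/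
theorem supConv_sub_hermForm_continuousOn_and_isQPSHOn {n q : ℕ} {δ : ℝ}
    {Φ : EuclideanSpace ℂ (Fin n) → ℝ} (hΦδ : IsSemiconvex δ Φ)
    {U : Set (EuclideanSpace ℂ (Fin n))} (hU : IsOpen U)
    {u : EuclideanSpace ℂ (Fin n) → EReal} (hu : IsQPSHOn q u U)
    (A : Matrix (Fin n) (Fin n) ℂ) {W : Set (EuclideanSpace ℂ (Fin n))}
    (hW : W = interior (properSet (fun x => u x + (hermForm A x : EReal))
      (fun x => (Φ x : EReal)) U)) :
    ContinuousOn (fun y => supConv (fun x => u x + (hermForm A x : EReal))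
      (fun x => (Φ x : EReal)) U y - (hermForm A y : EReal)) W ∧
    ((∃ x ∈ U, u x ≠ ⊥) → ∀ y ∈ W, ∃ t : ℝ,
      supConv (fun x => u x + (hermForm A x : EReal))
        (fun x => (Φ x : EReal)) U y - (hermForm A y : EReal) = (t : EReal)) ∧
    IsQPSHOn q (fun y => supConv (fun x => u x + (hermForm A x : EReal))
      (fun x => (Φ x : EReal)) U y - (hermForm A y : EReal)) W := by
  set S := supConv (fun x => u x + (hermForm A x : EReal)) (fun x => (Φ x : EReal)) U with hS
  have hWo : IsOpen W := hW ▸ isOpen_interior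
  by_cases hex : ∃ x ∈ U, u x ≠ ⊥
  swap
  · push Not at hex
    have hbot : (fun y => S y - (hermForm A y : EReal)) = fun _ => ⊥ := by
      funext y
      have : S y = ⊥ := by
        simp only [hS, supConv, iSup_eq_bot]
        intro x hx
        rw [hex x hx, EReal.bot_add, EReal.bot_add]
      rw [this, EReal.bot_sub]
    rw [hbot]
    refine ⟨continuousOn_const, fun ⟨x, hx, hne⟩ => (hne (hex x hx)).elim,
      continuousOn_const.upperSemicontinuousOn, fun _ _ => bot_lt_top, fun _ π _ =>
      ⟨continuousOn_const.upperSemicontinuousOn, fun _ _ => bot_lt_top, Or.inl fun _ _ => rfl⟩⟩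
  have hle : ∀ y, ∀ x ∈ U, u x + (hermForm A x : EReal) + (Φ (y - x) : EReal) ≤ S y :=
    fun y x hx => le_iSup₂ (f := fun x (_ : x ∈ U) =>
      u x + (hermForm A x : EReal) + (Φ (y - x) : EReal)) x hx
  have hne : ∀ y, S y ≠ ⊥ := by
    intro y hy
    obtain ⟨x, hx, hux⟩ := hex
    have := hle y x hx
    rw [hy, le_bot_iff] at this
    lift u x to ℝ using ⟨(hu.2.1 x hx).ne, hux⟩ with ux
    norm_cast at this
  have hatt : ∀ y ∈ W, ∃ x ∈ U, ∃ t : ℝ, u x = t ∧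
      S y = ((t + hermForm A x + Φ (y - x) : ℝ) : EReal) := by
    intro y hy
    rw [hW] at hy
    obtain ⟨x, hx, heq⟩ := interior_subset hy
    change S y = u x + (hermForm A x : EReal) + (Φ (y - x) : EReal) at heq
    have hux : u x ≠ ⊥ := by
      intro hb
      rw [hb, EReal.bot_add, EReal.bot_add] at heq
      exact hne y heq
    refine ⟨x, hx, (u x).toReal, (EReal.coe_toReal (hu.2.1 x hx).ne hux).symm, ?_⟩
    rw [heq, EReal.coe_add, EReal.coe_add, EReal.coe_toReal (hu.2.1 x hx).ne hux]
  set F : EuclideanSpace ℂ (Fin n) → ℝ := fun y => (S y).toReal with hFdef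
  have hF : ∀ y ∈ W, S y = (F y : EReal) := by
    intro y hy
    obtain ⟨x, -, t, -, heq⟩ := hatt y hy
    simp only [hFdef, heq, EReal.toReal_coe]
  have hFcont : ContinuousOn F W := by
    refine continuousOn_of_semiconvex_touching hΦδ hWo fun y hy => ?_
    obtain ⟨x, hx, t, hux, heq⟩ := hatt y hy
    refine ⟨x, t + hermForm A x, ?_, fun z hz => ?_⟩
    · rw [hF y hy] at heq
      exact_mod_cast heq
    · have := hle z x hx
      rw [hux, hF z hz] at this
      exact_mod_cast this
  have hfcont : ContinuousOn (fun y => F y - hermForm A y) W :=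
    hFcont.sub (continuous_hermForm A).continuousOn
  have heqOn : Set.EqOn (fun y => S y - (hermForm A y : EReal))
      (fun y => ((F y - hermForm A y : ℝ) : EReal)) W := by
    intro y hy
    simp only [hF y hy, EReal.coe_sub]
  have hq : IsQPSHOn q (fun y => ((F y - hermForm A y : ℝ) : EReal)) W := by
    refine isQPSHOn_of_touching hU hu hfcont fun y hy => ?_
    obtain ⟨x, hx, t, hux, heq⟩ := hatt y hy
    obtain ⟨φ, hφ⟩ := hermForm_add_eq A (y - x)
    refine ⟨x, hx, -φ, Φ (y - x) - hermForm A (y - x), ?_, fun x' hx' hxW => ?_⟩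
    · rw [hF y hy, EReal.coe_eq_coe_iff] at heq
      have h1 := hφ x
      rw [add_sub_cancel] at h1
      rw [hux, ← EReal.coe_add, EReal.coe_eq_coe_iff, heq, h1, neg_apply]
      ring
    · have h1 := hle (x' + (y - x)) x' hx'
      rw [hF _ hxW, add_sub_cancel_left] at h1
      by_cases hb : u x' = ⊥
      · rw [hb, EReal.bot_add]
        exact bot_le
      lift u x' to ℝ using ⟨(hu.2.1 x' hx').ne, hb⟩ with ux
      norm_cast at h1 ⊢
      rw [hφ x', neg_apply]
      linarith
  refine ⟨(continuous_coe_real_ereal.comp_continuousOn hfcont).congr heqOn,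
    fun _ y hy => ⟨_, heqOn hy⟩, hq.congr heqOn⟩

theorem mainTheorem3 (n q : ℕ) (δ : ℝ) (Φ : EuclideanSpace ℂ (Fin n) → ℝ)
    (hΦ : Continuous Φ) (hΦδ : IsSemiconvex δ Φ)
    (U : Set (EuclideanSpace ℂ (Fin n))) (hU : IsOpen U) (hUne : U.Nonempty)
    (u : EuclideanSpace ℂ (Fin n) → EReal) (hu : IsQPSHOn q u U) :
    (∀ A : Matrix (Fin n) (Fin n) ℂ, A.IsHermitian →
      ∀ W : Set (EuclideanSpace ℂ (Fin n)),
        W = interior (properSet (fun x => u x + (hermForm A x : EReal))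
          (fun x => (Φ x : EReal)) U) →
        W.Nonempty →
        ContinuousOn (fun y => supConv (fun x => u x + (hermForm A x : EReal))
          (fun x => (Φ x : EReal)) U y - (hermForm A y : EReal)) W ∧
        ((∃ x ∈ U, u x ≠ ⊥) → ∀ y ∈ W, ∃ t : ℝ,
          supConv (fun x => u x + (hermForm A x : EReal))
            (fun x => (Φ x : EReal)) U y - (hermForm A y : EReal) = (t : EReal)) ∧
        IsQPSHOn q (fun y => supConv (fun x => u x + (hermForm A x : EReal))
          (fun x => (Φ x : EReal)) U y - (hermForm A y : EReal)) W) ∧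
    (∀ W : Set (EuclideanSpace ℂ (Fin n)),
      W = interior (properSet u (fun x => (Φ x : EReal)) U) →
      W.Nonempty →
      ContinuousOn (supConv u (fun x => (Φ x : EReal)) U) W ∧
      ((∃ x ∈ U, u x ≠ ⊥) → ∀ y ∈ W, ∃ t : ℝ,
        supConv u (fun x => (Φ x : EReal)) U y = (t : EReal)) ∧
      IsQPSHOn q (supConv u (fun x => (Φ x : EReal)) U) W) := by
  refine ⟨fun A _ W hW _ => supConv_sub_hermForm_continuousOn_and_isQPSHOn hΦδ hU hu A hW,
    fun W hW _ => ?_⟩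
  have h0 : ∀ x : EuclideanSpace ℂ (Fin n), ((hermForm 0 x : ℝ) : EReal) = 0 := fun x => by
    simp [hermForm]
  have := supConv_sub_hermForm_continuousOn_and_isQPSHOn hΦδ hU hu 0 (W := W)
  simp only [h0, add_zero, sub_zero] at this
  exact this hW
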